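/- Let $G$ be a topological group and $X$ a topological space. Let $\eta : G*X \to X$, $(g,x)\mapsto g\cdot x$, be a partial action of $G$ on $X$, that is, a function with domain $G*X\subseteq G\times X$ such that for all $g,h\in G$ and $x\in X$: if $(g,x)\in G*X$, then $(g^{-1},g\cdot x)\in G*X$ and $g^{-1}\cdot(g\cdot x)=x$; if $(h,x)\in G*X$ and $(g,h\cdot x)\in G*X$, then $(gh,x)\in G*X$ and $g\cdot(h\cdot x)=(gh)\cdot x$; and $(1,x)\in G*X$ with $1\cdot x=x$. For $g\in G$ put $X_g=\{x\in X : (g^{-1},x)\in G*X\}$. Assume that $\eta$ is continuous, where $G*X$ carries the subspace topology of $G\times X$, that every $X_g$ is open in $X$, and that every map $\eta_g: X_{g^{-1}}\to X_g$, $x\mapsto g\cdot x$, is a homeomorphism. Let $X/\!\sim_G$ be the orbit space, with the quotient topology, of the equivalence relation $x\sim_G y \iff g\cdot x=y$ for some $g$ with $(g,x)\in G*X$. Let $X_G=(G\times X)/R$ be the enveloping space, with the quotient topology, where $(g,x)\,R\,(h,y)\iff (h^{-1}g,x)\in G*X$ and $(h^{-1}g)\cdot x=y$; the group $G$ acts (globally)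 on $X_G$ by $g\cdot[h,x]=[gh,x]$, and $X_G/\!\sim_G$ is the orbit space of this action, with the quotient topology. Consider the conditions (i) $G$ is countably compact and $X_G$ is metrizable; (ii) $G$ is compact and metrizable, $X$ is metrizable, and $G*X$ is closed in $G\times X$. If (i) or (ii) holds, then the topology of $X$ is induced by a metric $\rho$ with $\rho(g\cdot x,g\cdot y)=\rho(x,y)$ for all $g\in G$ and $x,y\in X_{g^{-1}}$, and the topology of $X_G$ is induced by a metric $\rho'$ with $\rho'(g\cdot a,g\cdot b)=\rho'(a,b)$ for all $g\in G$ and $a,b\in X_G$. Moreover, if (i) holds and $X_G/\!\sim_G$ is $T_1$, then $X/\!\sim_G$ is metrizable. -/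

import Mathlib

/-- A (set-theoretic) partial action of a group `G` on a set `X`: a function `(g, x) ↦ g · x`
defined on a subset `dom` (written `G * X` on paper) of `G × X`; `∃ g · x` means `(g, x) ∈ dom`. -/
structure PartialAction (G : Type*) (X : Type*) [Group G] where
  /-- The domain `G * X`. -/
  dom : Set (G × X)
  /-- The map `G * X → X`. -/
  act : dom → X
  /-- If `∃ g · x`, then `∃ g⁻¹ · (g · x)` and `g⁻¹ · (g · x) = x`. -/
  inv_act : ∀ (g : G) (x : X) (h : (g, x) ∈ dom),
    ∃ h' : (g⁻¹, act ⟨(g, x), h⟩) ∈ dom, act ⟨(g⁻¹, act ⟨(g, x), h⟩), h'⟩ = x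
  /-- If `∃ g · (h · x)`, then `∃ (g h) · x` and `g · (h · x) = (g h) · x`. -/
  act_act : ∀ (g h : G) (x : X) (hx : (h, x) ∈ dom) (hgx : (g, act ⟨(h, x), hx⟩) ∈ dom),
    ∃ h' : (g * h, x) ∈ dom, act ⟨(g, act ⟨(h, x), hx⟩), hgx⟩ = act ⟨(g * h, x), h'⟩
  /-- `∃ 1 · x` and `1 · x = x`. -/
  one_act : ∀ x : X, ∃ h : ((1 : G), x) ∈ dom, act ⟨(1, x), h⟩ = x

namespace PartialAction

variable {G : Type*} {X : Type*} [Group G]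

section Algebra

variable (η : PartialAction G X)

/-- The set `X_g = {x | ∃ g⁻¹ · x}`. -/
def domAt (g : G) : Set X := {x | (g⁻¹, x) ∈ η.dom}

theorem mem_dom_of_mem_domAt_inv {g : G} {x : X} (hx : x ∈ η.domAt g⁻¹) : (g, x) ∈ η.dom := by
  simpa [domAt] using hx

/-- The map `η_g : X_{g⁻¹} → X_g`, `x ↦ g · x`. -/
def mapAt (g : G) (x : η.domAt g⁻¹) : η.domAt g :=
  ⟨η.act ⟨(g, x.1), η.mem_dom_of_mem_domAt_inv x.2⟩, (η.inv_act g x.1 _).1⟩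

/-- The orbit equivalence relation: `x ∼ y` iff `∃ g · x` and `g · x = y` for some `g`. -/
def orbitSetoid : Setoid X where
  r x y := ∃ (g : G) (h : (g, x) ∈ η.dom), η.act ⟨(g, x), h⟩ = y
  iseqv :=
    { refl := fun x => ⟨1, η.one_act x⟩
      symm := by
        rintro x _ ⟨g, h, rfl⟩
        exact ⟨g⁻¹, η.inv_act g x h⟩
      trans := by
        rintro x _ _ ⟨g, h, rfl⟩ ⟨k, h', rfl⟩
        obtain ⟨h'', e⟩ := η.act_act k g x h h'
        exact ⟨k * g, h'', e.symm⟩ }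

/-- The orbit space `X / ∼_G`. -/
def OrbitSpace : Type _ := Quotient η.orbitSetoid

/-- The relation `R` on `G × X` that defines the enveloping space: `(g, x) R (h, y)` iff
`x ∈ X_{g⁻¹ h}`, that is `∃ (h⁻¹ g) · x`, and `(h⁻¹ g) · x = y`. -/
def envSetoid : Setoid (G × X) where
  r p q := ∃ h : (q.1⁻¹ * p.1, p.2) ∈ η.dom, η.act ⟨(q.1⁻¹ * p.1, p.2), h⟩ = q.2
  iseqv :=
    { refl := by
        rintro ⟨g, x⟩
        simpa using η.one_act x
      symm := by
        rintro ⟨g, x⟩ ⟨h, y⟩ ⟨hd, e⟩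
        dsimp only at hd e ⊢
        subst e
        simpa using η.inv_act (h⁻¹ * g) x hd
      trans := by
        rintro ⟨g, x⟩ ⟨h, y⟩ ⟨k, z⟩ ⟨hd, e⟩ ⟨hd', e'⟩
        dsimp only at hd e hd' e' ⊢
        subst e
        subst e'
        obtain ⟨h'', e⟩ := η.act_act (k⁻¹ * h) (h⁻¹ * g) x hd hd'
        have e1 : k⁻¹ * h * (h⁻¹ * g) = k⁻¹ * g := by group
        simp only [e1] at h'' e
        exact ⟨h'', e.symm⟩ }

/-- The enveloping space (globalization) `X_G = (G × X) / R`. -/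
def EnvelopingSpace : Type _ := Quotient η.envSetoid

/-- The enveloping action `g • [h, x] = [g h, x]` of `G` on `X_G`. -/
instance : MulAction G η.EnvelopingSpace where
  smul g := Quotient.map (fun p => (g * p.1, p.2)) (by
    rintro ⟨h, x⟩ ⟨k, y⟩ ⟨hd, e⟩
    have e1 : (g * k)⁻¹ * (g * h) = k⁻¹ * h := by group
    change ∃ h' : ((g * k)⁻¹ * (g * h), x) ∈ η.dom, η.act ⟨((g * k)⁻¹ * (g * h), x), h'⟩ = y
    simp only [e1]
    exact ⟨hd, e⟩)
  one_smul := by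
    rintro ⟨h, x⟩
    exact congrArg (Quotient.mk η.envSetoid) (Prod.ext (one_mul h) rfl)
  mul_smul g k := by
    rintro ⟨h, x⟩
    exact congrArg (Quotient.mk η.envSetoid) (Prod.ext (mul_assoc g k h) rfl)

end Algebra

section Topology

variable [TopologicalSpace G] [τ : TopologicalSpace X] (η : PartialAction G X)

/-- `η` is continuous: `G * X → X` is continuous, `G * X` having the subspace topology. -/
def IsContinuous : Prop := Continuous η.act

/-- `η` is topological: every `X_g` is open and every `η_g : X_{g⁻¹} → X_g` is a homeomorphism. -/
def IsTopological : Prop := ∀ g : G, IsOpen (η.domAt g) ∧ IsHomeomorph (η.mapAt g)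

/-- The quotient topology on the orbit space. -/
instance : TopologicalSpace η.OrbitSpace :=
  inferInstanceAs (TopologicalSpace (Quotient η.orbitSetoid))

/-- The quotient topology (of the product topology on `G × X`) on the enveloping space. -/
instance : TopologicalSpace η.EnvelopingSpace :=
  inferInstanceAs (TopologicalSpace (Quotient η.envSetoid))

/-- `X` has a metric that induces its topology and is `η`-invariant:
`ρ (g · x) (g · y) = ρ x y` for all `g` and all `x, y ∈ X_{g⁻¹}`. -/
def HasInvariantMetric : Prop :=
  ∃ ρ : MetricSpace X,
    ρ.toUniformSpace.toTopologicalSpace = τ ∧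
    ∀ (g : G) (x y : η.domAt g⁻¹), ρ.dist (η.mapAt g x) (η.mapAt g y) = ρ.dist x y

end Topology

end PartialAction

/-- `Y` has a metric that induces its topology and is invariant under the (global) action
of `G` on `Y`. -/
def HasInvariantMetric (G : Type*) (Y : Type*) [Group G] [MulAction G Y]
    [τ : TopologicalSpace Y] : Prop :=
  ∃ ρ : MetricSpace Y,
    ρ.toUniformSpace.toTopologicalSpace = τ ∧
    ∀ (g : G) (x y : Y), ρ.dist (g • x) (g • y) = ρ.dist x y

/-! Everything is done on the enveloping space, where the action is global. If a countably compact
group acts continuously on a metrizable space, the action is equicontinuous, so the supremum over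
the group of a truncated translated metric is invariant and still induces the topology. `ι` is an
equivariant embedding, so this metric restricts to an invariant one on `X`. Condition (ii) leads
back to (i): the map `toEnv` is then open, closed and has compact fibres, and such maps preserve
metrizability. For an isometric action, the distance between orbits is a pseudometric inducing the
quotient topology; T₁ turns metrizability up to separation into metrizability. Both orbit spaces
agree. -/

open Filter Set Topology TopologicalSpace

/-- The image of a metrizable space under a continuous map that is open, closed and has compact
fibres is metrizable: it embeds into the hyperspace of nonempty compact sets via its fibres. -/
theorem metrizableSpace_of_isOpenMap_isClosedMap {A B : Type*} [TopologicalSpace A]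
    [TopologicalSpace B] [MetrizableSpace A] {f : A → B} (hf : Continuous f)
    (hs : Function.Surjective f) (ho : IsOpenMap f) (hcl : IsClosedMap f)
    (hk : ∀ b, IsCompact (f ⁻¹' {b})) : MetrizableSpace B := by
  let _ := metrizableSpaceMetric A
  let F : B → NonemptyCompacts A := fun b => ⟨⟨f ⁻¹' {b}, hk b⟩, hs b⟩
  have hF : ∀ b, (F b : Set A) = f ⁻¹' {b} := fun _ => rfl
  have hpow : ∀ S : Set A, {b | (F b : Set A) ⊆ S} = (f '' Sᶜ)ᶜ := by
    intro S
    ext b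
    simp only [hF, mem_ofPred_eq, mem_compl_iff, mem_image, not_exists, not_and]
    exact ⟨fun h a ha hab => ha (h hab), fun h a hab => by_contra fun ha => h a ha hab⟩
  have hFc : Continuous F := by
    let _ : TopologicalSpace (Set A) := TopologicalSpace.vietoris A
    rw [NonemptyCompacts.isEmbedding_coe.continuous_iff, vietoris.continuous_iff]
    -- The upper half of the Vietoris topology uses that `f` is closed, the lower half that `f` is
    -- open.
    refine ⟨fun U hU => ?_, fun C hC => ?_⟩
    · change IsOpen {b | (F b : Set A) ⊆ U}
      rw [hpow]
      exact (hcl _ hU.isClosed_compl).isOpen_compl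
    · change IsClosed {b | (F b : Set A) ⊆ C}
      rw [hpow]
      exact (ho _ hC.isOpen_compl).isClosed_compl
  have hemb : IsEmbedding F := by
    refine ⟨⟨le_antisymm hFc.le_induced fun V hV => ?_⟩, fun b c hbc => ?_⟩
    · refine isOpen_induced_iff.2 ⟨{K | (K : Set A) ⊆ f ⁻¹' V},
        NonemptyCompacts.isOpen_subsets_of_isOpen (hV.preimage hf), ?_⟩
      change {b | (F b : Set A) ⊆ f ⁻¹' V} = V
      rw [hpow, ← preimage_compl, image_preimage_eq _ hs, compl_compl]
    · obtain ⟨a, rfl⟩ := hs b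
      have : a ∈ (F c : Set A) := hbc ▸ (rfl : f a = f a)
      exact this
  exact hemb.metrizableSpace

/-! ### Global actions: invariant metrics and orbit pseudometrics -/

section GlobalAction

variable {G Y : Type*} [Group G] [MulAction G Y]

/-- An action of a countably compact group on a metric space is equicontinuous. -/
theorem eventually_forall_dist_smul_lt [TopologicalSpace G] [CountablyCompactSpace G]
    [PseudoMetricSpace Y] [ContinuousSMul G Y] (x : Y) {ε : ℝ} (hε : 0 < ε) :
    ∀ᶠ y in 𝓝 x, ∀ g : G, dist (g • x) (g • y) < ε := by
  by_contra hcon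
  obtain ⟨y, hy, hyn⟩ := exists_seq_forall_of_frequently (not_eventually.1 hcon)
  push Not at hyn
  choose g hg using hyn
  -- A cluster point of `g` suffices: `y` converges to `x`, so some `n` has `g n` near `a` and `y n`
  -- near `x` at once.
  obtain ⟨a, -, ha⟩ := (CountablyCompactSpace.isCountablyCompact_univ (E := G)).seq_clusterPt g
    (by simp)
  have hsm : Tendsto (fun p : G × Y => p.1 • p.2) (𝓝 a ×ˢ 𝓝 x) (𝓝 (a • x)) := by
    rw [← nhds_prod_eq]
    exact continuous_smul.tendsto (a, x)
  obtain ⟨U, hU, V, hV, hUV⟩ := mem_prod_iff.1 (hsm (Metric.ball_mem_nhds (a • x) (half_pos hε)))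
  obtain ⟨n, hgn, hyn⟩ := ((mapClusterPt_iff_frequently.1 ha U hU).and_eventually (hy hV)).exists
  have h1 : dist (g n • y n) (a • x) < ε / 2 := hUV (mk_mem_prod hgn hyn)
  have h2 : dist (g n • x) (a • x) < ε / 2 := hUV (mk_mem_prod hgn (mem_of_mem_nhds hV))
  have h3 := dist_triangle_right (g n • x) (g n • y n) (a • x)
  linarith [hg n]

/-- A continuous action of a countably compact group on a metrizable space admits an invariant
compatible metric. -/
theorem hasInvariantMetric_of_countablyCompactSpace [TopologicalSpace G] [CountablyCompactSpace G]
    [TopologicalSpace Y] [MetrizableSpace Y] [ContinuousSMul G Y] : HasInvariantMetric G Y := by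
  let _ := metrizableSpaceMetric Y
  -- Truncating at 1 bounds the supremum and leaves small distances unchanged.
  let δ : Y → Y → G → ℝ := fun x y g => min 1 (dist (g • x) (g • y))
  let D : Y → Y → ℝ := fun x y => ⨆ g, δ x y g
  have hbdd : ∀ x y, BddAbove (range (δ x y)) := fun x y =>
    ⟨1, by rintro _ ⟨g, rfl⟩; exact min_le_left _ _⟩
  have hle : ∀ x y g, δ x y g ≤ D x y := fun x y g => le_ciSup (hbdd x y) g
  have hone : ∀ x y, min 1 (dist x y) ≤ D x y := fun x y => by simpa [δ] using hle x y 1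
  have hself : ∀ x, D x x = 0 := fun x => by simp [D, δ]
  have hcomm : ∀ x y, D x y = D y x := fun x y => by simp [D, δ, dist_comm]
  have htri : ∀ x y z, D x z ≤ D x y + D y z := by
    refine fun x y z => ciSup_le fun g => ?_
    refine le_trans ?_ (add_le_add (hle x y g) (hle y z g))
    have := dist_triangle (g • x) (g • y) (g • z)
    have h1 : 0 ≤ dist (g • x) (g • y) := dist_nonneg
    have h2 : 0 ≤ dist (g • y) (g • z) := dist_nonneg
    simp only [δ]
    rcases min_cases 1 (dist (g • x) (g • z)) with h | h <;>
    rcases min_cases 1 (dist (g • x) (g • y)) with h' | h' <;>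
    rcases min_cases 1 (dist (g • y) (g • z)) with h'' | h'' <;> linarith
  have hopen : ∀ s : Set Y, IsOpen s ↔ ∀ x ∈ s, ∃ ε > 0, ∀ y, D x y < ε → y ∈ s := by
    refine fun s => ⟨fun hs x hx => ?_, fun hs => isOpen_iff_mem_nhds.2 fun x hx => ?_⟩
    · obtain ⟨ε, hε, hball⟩ := Metric.isOpen_iff.1 hs x hx
      refine ⟨min 1 ε, lt_min one_pos hε, fun y hy => hball ?_⟩
      rw [Metric.mem_ball']
      have h := (hone x y).trans_lt hy
      by_contra! hlt
      exact absurd h (not_lt.2 (min_le_min_left 1 hlt))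
    · obtain ⟨ε, hε, hsub⟩ := hs x hx
      filter_upwards [eventually_forall_dist_smul_lt (G := G) x (half_pos hε)] with y hy
      refine hsub y (lt_of_le_of_lt (ciSup_le fun g => ?_) (half_lt_self hε))
      exact (min_le_right _ _).trans (hy g).le
  have heq : ∀ x y, D x y = 0 → x = y := by
    intro x y h
    have h1 := hone x y
    rw [h] at h1
    by_contra hne
    exact absurd h1 (not_le.2 (lt_min one_pos (dist_pos.2 hne)))
  refine ⟨MetricSpace.ofDistTopology D hself hcomm htri hopen heq, rfl, fun k x y => ?_⟩
  change (⨆ g, δ (k • x) (k • y) g) = ⨆ g, δ x y g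
  rw [← (Equiv.mulRight k).iSup_comp (g := δ x y)]
  simp [δ, mul_smul]

/-- The orbit space of an isometric action is pseudometrizable. -/
theorem pseudoMetrizableSpace_orbitRel_quotient [PseudoMetricSpace Y] [IsIsometricSMul G Y] :
    PseudoMetrizableSpace (Quotient (MulAction.orbitRel G Y)) := by
  let D : Y → Y → ℝ := fun x y => ⨅ g : G, dist x (g • y)
  have hbdd : ∀ x y : Y, BddBelow (range fun g : G => dist x (g • y)) := fun x y =>
    ⟨0, by rintro _ ⟨g, rfl⟩; exact dist_nonneg⟩
  have hle : ∀ (x y : Y) (g : G), D x y ≤ dist x (g • y) := fun x y g => ciInf_le (hbdd x y) g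
  have hsmul_right : ∀ x y (k : G), D x (k • y) = D x y := by
    intro x y k
    simp only [D, ← mul_smul]
    exact (Equiv.mulRight k).iInf_comp (g := fun g : G => dist x (g • y))
  have hcomm : ∀ x y, D x y = D y x := by
    intro x y
    simp only [D]
    rw [← (Equiv.inv G).iInf_comp (g := fun g : G => dist y (g • x))]
    refine iInf_congr fun g => ?_
    rw [Equiv.inv_apply, ← dist_smul g y (g⁻¹ • x), smul_inv_smul, dist_comm]
  have hsmul_left : ∀ x y (k : G), D (k • x) y = D x y := fun x y k => by
    rw [hcomm, hsmul_right, hcomm]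
  let E : Quotient (MulAction.orbitRel G Y) → Quotient (MulAction.orbitRel G Y) → ℝ :=
    Quotient.lift₂ D (by
      rintro x y _ _ ⟨g, rfl⟩ ⟨h, rfl⟩
      exact (hsmul_left _ _ _).trans (hsmul_right _ _ _))
  have hself : ∀ a, E a a = 0 := by
    rintro ⟨x⟩
    refine le_antisymm ?_ (Real.iInf_nonneg fun g : G => dist_nonneg (x := x) (y := g • x))
    simpa using hle x x 1
  have hEcomm : ∀ a b, E a b = E b a := by
    rintro ⟨x⟩ ⟨y⟩
    exact hcomm x y
  have htri : ∀ a b c, E a c ≤ E a b + E b c := by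
    rintro ⟨x⟩ ⟨y⟩ ⟨z⟩
    change D x z ≤ D x y + D y z
    refine le_of_forall_pos_lt_add fun ε hε => ?_
    obtain ⟨g, hg⟩ := exists_lt_of_ciInf_lt (lt_add_of_pos_right (D x y) (half_pos hε))
    obtain ⟨h, hh⟩ := exists_lt_of_ciInf_lt (lt_add_of_pos_right (D y z) (half_pos hε))
    have h1 := hle x z (g * h)
    have h2 := dist_triangle x (g • y) (g • h • z)
    -- Invariance lets the near-optimal translate `h • z` of `z` for `y` be moved along with `y` by
    -- `g`.
    rw [dist_smul] at h2
    rw [mul_smul] at h1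
    linarith
  have hopen : ∀ s, IsOpen s ↔ ∀ a ∈ s, ∃ ε > 0, ∀ b, E a b < ε → b ∈ s := by
    intro s
    rw [← isQuotientMap_quotient_mk'.isOpen_preimage, Metric.isOpen_iff]
    constructor
    · rintro hs ⟨x⟩ hx
      obtain ⟨ε, hε, hball⟩ := hs x hx
      refine ⟨ε, hε, ?_⟩
      rintro ⟨y⟩ hy
      obtain ⟨g, hg⟩ := exists_lt_of_ciInf_lt (show D x y < ε from hy)
      have hmem : (Quotient.mk (MulAction.orbitRel G Y) (g • y)) ∈ s :=
        hball (Metric.mem_ball'.2 hg)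
      rwa [show Quotient.mk (MulAction.orbitRel G Y) (g • y) = Quotient.mk _ y from
        Quotient.sound ⟨g, rfl⟩] at hmem
    · intro hs x hx
      obtain ⟨ε, hε, hsub⟩ := hs _ hx
      refine ⟨ε, hε, fun y hy => hsub _ ?_⟩
      refine lt_of_le_of_lt ?_ (Metric.mem_ball'.1 hy)
      change D x y ≤ dist x y
      simpa using hle x y 1
  let _ := PseudoMetricSpace.ofDistTopology E hself hEcomm htri hopen
  infer_instance

end GlobalAction

/-! ### The enveloping space and its quotient map -/

namespace PartialAction

variable {G X : Type*} [Group G] (η : PartialAction G X)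

/-- The quotient map `G × X → X_G`. -/
def toEnv : G × X → η.EnvelopingSpace := Quotient.mk η.envSetoid

/-- The canonical map `X → X_G`, `x ↦ [1, x]`. -/
def ι (x : X) : η.EnvelopingSpace := η.toEnv (1, x)

variable {η}

theorem toEnv_surjective : Function.Surjective η.toEnv := Quotient.mk_surjective

theorem toEnv_eq_iff {p q : G × X} : η.toEnv p = η.toEnv q ↔
    ∃ h : (q.1⁻¹ * p.1, p.2) ∈ η.dom, η.act ⟨(q.1⁻¹ * p.1, p.2), h⟩ = q.2 :=
  Quotient.eq (r := η.envSetoid)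

theorem smul_toEnv (g : G) (p : G × X) : g • η.toEnv p = η.toEnv (g * p.1, p.2) := rfl

theorem smul_ι (g : G) (x : X) : g • η.ι x = η.toEnv (g, x) := by
  simp [ι, smul_toEnv]

theorem toEnv_eq_ι_iff {p : G × X} {y : X} : η.toEnv p = η.ι y ↔
    ∃ h : p ∈ η.dom, η.act ⟨p, h⟩ = y := by
  rw [ι, toEnv_eq_iff]
  simp

theorem ι_act (p : η.dom) : η.ι (η.act p) = p.1.1 • η.ι p.1.2 := by
  rw [smul_ι]
  exact (toEnv_eq_ι_iff.2 ⟨p.2, rfl⟩).symm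

theorem ι_injective : Function.Injective η.ι := by
  intro x y h
  obtain ⟨h1, rfl⟩ := toEnv_eq_ι_iff.1 h
  exact (η.one_act x).2.symm

variable (η) in
/-- The pairs `(k, (h, y))` for which `k⁻¹ · y` is defined. -/
def shearDom : Set (G × (G × X)) := {t | (t.1⁻¹, t.2.2) ∈ η.dom}

variable (η) in
/-- The map `(k, (h, y)) ↦ (h k, k⁻¹ · y)`. For fixed `(h, y)` its values form the class
of `(h, y)` in the enveloping space. -/
def shear (t : η.shearDom) : G × X := (t.1.2.1 * t.1.1, η.act ⟨(t.1.1⁻¹, t.1.2.2), t.2⟩)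

theorem toEnv_eq_iff_exists_shear {p q : G × X} : η.toEnv p = η.toEnv q ↔
    ∃ (k : G) (h : (k, q) ∈ η.shearDom), η.shear ⟨(k, q), h⟩ = p := by
  rw [eq_comm, toEnv_eq_iff]
  constructor
  · rintro ⟨h, e⟩
    have e1 : (q.1⁻¹ * p.1)⁻¹ = p.1⁻¹ * q.1 := by group
    refine ⟨q.1⁻¹ * p.1, by simpa only [shearDom, mem_ofPred_eq, e1] using h, ?_⟩
    refine Prod.ext (by simp [shear]) ?_
    simpa only [shear, e1] using e
  · rintro ⟨k, h, rfl⟩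
    have e1 : (q.1 * k)⁻¹ * q.1 = k⁻¹ := by group
    simp only [shear, e1]
    exact ⟨h, trivial⟩

variable [TopologicalSpace G] [TopologicalSpace X]

theorem continuous_toEnv : Continuous η.toEnv := continuous_quotient_mk'

theorem isQuotientMap_toEnv : IsQuotientMap η.toEnv := isQuotientMap_quotient_mk'

theorem continuous_ι : Continuous η.ι := continuous_toEnv.comp (by fun_prop)

section

variable [IsTopologicalGroup G]

theorem continuous_shear (hc : η.IsContinuous) : Continuous η.shear := by
  refine Continuous.prodMk (by fun_prop) (hc.comp ?_)
  exact Continuous.subtype_mk (by fun_prop) _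

/-- The saturation of an open set is a union over `k` of preimages under `shear` with `k` fixed,
each defined on an open set. Openness of the whole domain `G * X` is not needed. -/
theorem isOpenMap_toEnv (hc : η.IsContinuous) (hd : ∀ g, IsOpen (η.domAt g)) :
    IsOpenMap η.toEnv := by
  intro O hO
  rw [← isQuotientMap_toEnv.isOpen_preimage]
  have key : η.toEnv ⁻¹' (η.toEnv '' O) =
      ⋃ k : G, Subtype.val '' {q : {q : G × X | q.2 ∈ η.domAt k} |
        η.shear ⟨(k, q.1), q.2⟩ ∈ O} := by
    ext q
    simp only [mem_preimage, mem_image, mem_iUnion, toEnv_eq_iff_exists_shear]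
    constructor
    · rintro ⟨_, hp, k, h, rfl⟩
      exact ⟨k, ⟨q, h⟩, hp, rfl⟩
    · rintro ⟨k, ⟨q, h⟩, hp, rfl⟩
      exact ⟨_, hp, k, h, rfl⟩
  rw [key]
  refine isOpen_iUnion fun k => ?_
  refine ((hd k).preimage continuous_snd).isOpenMap_subtype_val _ (hO.preimage ?_)
  exact (continuous_shear hc).comp (Continuous.subtype_mk (by fun_prop) _)

/-- The saturation of a closed set is the projection along the compact factor `G` of a closed set.
-/
theorem isClosedMap_toEnv [CompactSpace G] (hc : η.IsContinuous) (hcl : IsClosed η.dom) :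
    IsClosedMap η.toEnv := by
  intro C hC
  rw [← isQuotientMap_toEnv.isClosed_preimage]
  have key : η.toEnv ⁻¹' (η.toEnv '' C) =
      Prod.snd '' (Subtype.val '' (η.shear ⁻¹' C) : Set (G × (G × X))) := by
    ext q
    simp only [mem_preimage, mem_image, toEnv_eq_iff_exists_shear]
    constructor
    · rintro ⟨_, hp, k, h, rfl⟩
      exact ⟨(k, q), ⟨⟨(k, q), h⟩, hp, rfl⟩, rfl⟩
    · rintro ⟨_, ⟨⟨⟨k, q⟩, h⟩, hp, rfl⟩, rfl⟩
      exact ⟨_, hp, k, h, rfl⟩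
  rw [key]
  have hT : IsClosed η.shearDom := hcl.preimage (f := fun t : G × (G × X) => (t.1⁻¹, t.2.2))
    (by fun_prop)
  exact isClosedMap_snd_of_compactSpace _
    (hT.isClosedMap_subtype_val _ (hC.preimage (continuous_shear hc)))

theorem isCompact_toEnv_fiber [CompactSpace G] (hc : η.IsContinuous) (hcl : IsClosed η.dom)
    (a : η.EnvelopingSpace) : IsCompact (η.toEnv ⁻¹' {a}) := by
  obtain ⟨q, rfl⟩ := toEnv_surjective a
  have hK : IsClosed {k : G | (k, q) ∈ η.shearDom} :=
    hcl.preimage (f := fun k : G => (k⁻¹, q.2)) (by fun_prop)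
  have : CompactSpace {k : G | (k, q) ∈ η.shearDom} := isCompact_iff_compactSpace.1 hK.isCompact
  have key : η.toEnv ⁻¹' {η.toEnv q} =
      range fun k : {k : G | (k, q) ∈ η.shearDom} => η.shear ⟨(k.1, q), k.2⟩ := by
    ext p
    simp only [mem_preimage, mem_singleton_iff, toEnv_eq_iff_exists_shear, mem_range,
      Subtype.exists, mem_ofPred_eq]
  rw [key]
  exact isCompact_range ((continuous_shear hc).comp (Continuous.subtype_mk (by fun_prop) _))

/-- If `G` is compact metrizable, `X` is metrizable and `G * X` is closed, then the enveloping
space is metrizable. -/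
theorem metrizableSpace_envelopingSpace [CompactSpace G] [MetrizableSpace G] [MetrizableSpace X]
    (hc : η.IsContinuous) (hd : ∀ g, IsOpen (η.domAt g)) (hcl : IsClosed η.dom) :
    MetrizableSpace η.EnvelopingSpace :=
  metrizableSpace_of_isOpenMap_isClosedMap continuous_toEnv toEnv_surjective
    (isOpenMap_toEnv hc hd) (isClosedMap_toEnv hc hcl) (isCompact_toEnv_fiber hc hcl)

theorem continuousSMul_envelopingSpace (hc : η.IsContinuous) (hd : ∀ g, IsOpen (η.domAt g)) :
    ContinuousSMul G η.EnvelopingSpace := by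
  have hq : IsOpenQuotientMap η.toEnv := ⟨toEnv_surjective, continuous_toEnv, isOpenMap_toEnv hc hd⟩
  -- Openness of `toEnv` keeps its product with the identity of `G` a quotient map.
  refine ⟨(IsOpenQuotientMap.id.prodMap hq).continuous_comp_iff.1 ?_⟩
  change Continuous fun t : G × (G × X) => η.toEnv (t.1 * t.2.1, t.2.2)
  exact continuous_toEnv.comp (by fun_prop)

theorem isEmbedding_ι (hc : η.IsContinuous) (hd : ∀ g, IsOpen (η.domAt g)) :
    IsEmbedding η.ι := by
  refine ⟨⟨le_antisymm continuous_ι.le_induced fun V hV => ?_⟩, ι_injective⟩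
  -- `O` is open in `G × X` and meets `G * X` in the pairs acting into `V`, so the image of `O` in
  -- `X_G` traces exactly `V` on `X`.
  obtain ⟨O, hO, hOV⟩ := isOpen_induced_iff.1 (hV.preimage hc)
  refine isOpen_induced_iff.2 ⟨η.toEnv '' O, isOpenMap_toEnv hc hd O hO, ?_⟩
  have hmem : ∀ p : η.dom, p.1 ∈ O ↔ η.act p ∈ V := fun p => Set.ext_iff.1 hOV p
  ext x
  constructor
  · rintro ⟨p, hp, e⟩
    obtain ⟨h, rfl⟩ := toEnv_eq_ι_iff.1 e
    exact (hmem ⟨p, h⟩).1 hp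
  · intro hx
    obtain ⟨h, e⟩ := η.one_act x
    exact ⟨(1, x), (hmem ⟨_, h⟩).2 (by rwa [e]), rfl⟩

/-- An invariant metric on the enveloping space restricts to an invariant metric on `X`. -/
theorem hasInvariantMetric_of_envelopingSpace (hc : η.IsContinuous)
    (hd : ∀ g, IsOpen (η.domAt g)) (h : _root_.HasInvariantMetric G η.EnvelopingSpace) :
    η.HasInvariantMetric := by
  obtain ⟨ρ, hρ, hinv⟩ := h
  refine ⟨MetricSpace.induced η.ι ι_injective ρ, ?_, fun g x y => ?_⟩
  · rw [(isEmbedding_ι hc hd).eq_induced, ← hρ]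
    rfl
  · change ρ.dist (η.ι (η.act _)) (η.ι (η.act _)) = ρ.dist (η.ι x) (η.ι y)
    rw [ι_act, ι_act, hinv]

end

/-- The orbit spaces of a partial action and of its enveloping action are homeomorphic. -/
def orbitSpaceHomeomorph (η : PartialAction G X) :
    η.OrbitSpace ≃ₜ Quotient (MulAction.orbitRel G η.EnvelopingSpace) where
  toFun := Quotient.map η.ι (by
    rintro x _ ⟨g, h, rfl⟩
    exact ⟨g⁻¹, by simp [ι_act]⟩)
  invFun := Quotient.lift
    (Quotient.lift (fun p : G × X => (Quotient.mk η.orbitSetoid p.2 : η.OrbitSpace)) (by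
      rintro p q ⟨h, e⟩
      exact Quotient.sound ⟨_, h, e⟩)) (by
    rintro _ ⟨p⟩ ⟨g, rfl⟩
    rfl)
  left_inv := by
    rintro ⟨x⟩
    rfl
  right_inv := by
    rintro ⟨⟨g, x⟩⟩
    refine Quotient.sound ⟨g⁻¹, ?_⟩
    change g⁻¹ • η.toEnv (g, x) = η.ι x
    rw [smul_toEnv, ι]
    simp
  continuous_toFun := continuous_ι.quotient_map' _
  continuous_invFun :=
    Continuous.quotient_lift (Continuous.quotient_lift
      (continuous_quotient_mk'.comp continuous_snd) _) _

/-- If the enveloping space has an invariant compatible metric and a `T₁` orbit space, then the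
orbit space of the partial action is metrizable. -/
theorem metrizableSpace_orbitSpace (h : _root_.HasInvariantMetric G η.EnvelopingSpace)
    [hT : T1Space (Quotient (MulAction.orbitRel G η.EnvelopingSpace))] :
    MetrizableSpace η.OrbitSpace := by
  obtain ⟨ρ, hρ, hinv⟩ := h
  have hps : PseudoMetrizableSpace (Quotient (MulAction.orbitRel G η.EnvelopingSpace)) := by
    have : IsIsometricSMul G η.EnvelopingSpace :=
      ⟨fun g => Isometry.of_dist_eq fun x y => hinv g x y⟩
    have := pseudoMetrizableSpace_orbitRel_quotient (G := G) (Y := η.EnvelopingSpace)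
    rwa [hρ] at this
  exact η.orbitSpaceHomeomorph.isEmbedding.metrizableSpace

end PartialAction

theorem theorem3p8 {G : Type*} {X : Type*} [Group G] [TopologicalSpace G] [IsTopologicalGroup G]
    [TopologicalSpace X] (η : PartialAction G X) (hc : η.IsContinuous) (ht : η.IsTopological) :
    (CountablyCompactSpace G → TopologicalSpace.MetrizableSpace η.EnvelopingSpace →
      η.HasInvariantMetric ∧ HasInvariantMetric G η.EnvelopingSpace) ∧
    (CompactSpace G → TopologicalSpace.MetrizableSpace G → TopologicalSpace.MetrizableSpace X →
      IsClosed η.dom →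
      η.HasInvariantMetric ∧ HasInvariantMetric G η.EnvelopingSpace) ∧
    (CountablyCompactSpace G → TopologicalSpace.MetrizableSpace η.EnvelopingSpace →
      T1Space (Quotient (MulAction.orbitRel G η.EnvelopingSpace)) →
      TopologicalSpace.MetrizableSpace η.OrbitSpace) := by
  have hd : ∀ g, IsOpen (η.domAt g) := fun g => (ht g).1
  have := PartialAction.continuousSMul_envelopingSpace hc hd
  have hmain : CountablyCompactSpace G → TopologicalSpace.MetrizableSpace η.EnvelopingSpace →
      HasInvariantMetric G η.EnvelopingSpace := fun _ _ =>
    hasInvariantMetric_of_countablyCompactSpace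
  refine ⟨fun hG hY => ?_, fun hG _ _ hcl => ?_, fun hG hY _ => ?_⟩
  · exact ⟨PartialAction.hasInvariantMetric_of_envelopingSpace hc hd (hmain hG hY), hmain hG hY⟩
  · have h := hmain inferInstance (PartialAction.metrizableSpace_envelopingSpace hc hd hcl)
    exact ⟨PartialAction.hasInvariantMetric_of_envelopingSpace hc hd h, h⟩
  · exact PartialAction.metrizableSpace_orbitSpace (hmain hG hY)
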